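/- Let $(\Sigma,D)$ be a dependence alphabet ($\Sigma$ finite, $D\subseteq\Sigma\times\Sigma$ reflexive and symmetric). Two letters are independent if they are distinct and $(a,b)\notin D$. Let $\mathbb M=\Sigma^*/{\sim}$ be the trace monoid, where $\sim$ is the least congruence with $ab\sim ba$ for all independent $a,b$; let $[w]$ denote the trace of the word $w$ and $1=[\varepsilon]$. A set $\mathcal K\subseteq\mathbb M$ is recognizable if $\{w\in\Sigma^*\mid [w]\in\mathcal K\}$ is regular. Let $\mathcal F$ be the set of all sets $A\subseteq\Sigma$ of pairwise independent letters, and let $[A]\in\mathbb M$ be the product of the letters of $A$. A word $A_1\cdots A_n\in\mathcal F^*$ represents the trace $[A_1]\cdots[A_n]$; it is in extended Foata normal form if for all $1\le i<n$ every $b\in A_{i+1}$ satisfies $(a,b)\in D$ for some $a\in A_i$. For $\mathcal R\subseteq\mathbb M^2$ let $L_{\mathcal R}\subseteq(\mathcal F^2)^*$ be the set of words whose two component words are in extended Foata normal form and represent a pair of traces from $\mathcal R$. The relation $\mathcal R$ is fnf-automatic if $L_{\mathcal R}$ is regular. A trace-pushdown system (tPDS) is a tuple $\mathcal P=(Q,\Sigma,D,\Delta)$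 with $Q$ finite, $(\Sigma,D)$ a dependence alphabet and $\Delta\subseteq Q\times\Sigma\times\Sigma^*\times Q$ finite such that (P1) for every $(p,a,w,q)\in\Delta$, every letter dependent on some letter of $w$ is dependent on $a$, and (P2) if $(p,a,v,q),(q,b,w,r)\in\Delta$ with $a,b$ independent, then $(p,b,w,q'),(q',a,v,r)\in\Delta$ for some $q'\in Q$. On $Q\times\mathbb M$ let $(p,s)\vdash(q,t)$ if there are $(p,a,w,q)\in\Delta$ and $x\in\Sigma^*$ with $s=[xa]$ and $t=[xw]$. For $p,q\in Q$ let $\mathrm{reach}_{p,q}=\{(s,t)\in\mathbb M^2\mid (p,s)\vdash^*(q,t)\}$, where $\vdash^*$ is the reflexive and transitive closure of $\vdash$. **Proposition.** Let $\mathcal P=(Q,\Sigma,D,\Delta)$ be a tPDS with $\Delta\subseteq Q\times\Sigma\times\{\varepsilon\}\times Q$ and let $p,q\in Q$. Then $\mathrm{reach}_{p,q}$ is fnf-automatic, and there is a recognizable set $\mathcal K\subseteq\mathbb M$ with $$\mathrm{reach}_{p,q}=\mathrm{Id}_{\mathbb M}\cdot(\mathcal K\times\{1\})=\{(xy,x)\mid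 x\in\mathbb M,\ y\in\mathcal K\}.$$ Both statements are effective: there are algorithms that, given $\mathcal P$, $p$ and $q$, compute an NFA accepting $L_{\mathrm{reach}_{p,q}}$ and an NFA accepting $\{w\in\Sigma^*\mid[w]\in\mathcal K\}$ for such a set $\mathcal K$. -/

import Mathlib

open scoped Pointwise

/-! ## Dependence alphabets and Mazurkiewicz traces -/

/-- A dependence relation on the set of letters `Γ`: a reflexive and symmetric relation.
(Finiteness of `Γ` is a separate assumption.) -/
@[ext]
structure DependenceAlphabet (Γ : Type*) where
  Dep : Γ → Γ → Prop
  refl : ∀ a, Dep a a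
  symm : ∀ a b, Dep a b → Dep b a

namespace DependenceAlphabet

variable {Γ : Type*} (𝔻 : DependenceAlphabet Γ)

/-- The independence relation: distinct letters that are not dependent. -/
def Indep (a b : Γ) : Prop := a ≠ b ∧ ¬ 𝔻.Dep a b

/-- The generating relations `ab ∼ ba` for independent letters `a`, `b`. -/
inductive SwapRel : FreeMonoid Γ → FreeMonoid Γ → Prop
  | swap (a b : Γ) (h : 𝔻.Indep a b) :
      SwapRel (FreeMonoid.of a * FreeMonoid.of b) (FreeMonoid.of b * FreeMonoid.of a)

/-- The trace monoid: the free monoid modulo the least congruence with `ab ∼ ba` for all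
independent `a`, `b`. -/
abbrev Trace : Type _ := PresentedMonoid 𝔻.SwapRel

/-- The trace `[w]` induced by the word `w`. -/
def trace (w : List Γ) : 𝔻.Trace := PresentedMonoid.mk 𝔻.SwapRel (FreeMonoid.ofList w)

/-- A trace language is recognizable if the language of all words inducing one of its elements
is regular. -/
def Recognizable (K : Set 𝔻.Trace) : Prop :=
  Language.IsRegular ({w : List Γ | 𝔻.trace w ∈ K} : Language Γ)

/-! ### Foata normal forms -/

/-- The alphabet of all (finite) independent sets of letters. -/
abbrev IndepSet : Type _ := {A : Finset Γ // (A : Set Γ).Pairwise 𝔻.Indep}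

theorem commute_of_indep {a b : Γ} (h : 𝔻.Indep a b) :
    Commute (𝔻.trace [a]) (𝔻.trace [b]) :=
  PresentedMonoid.mk_eq_mk_of_rel (SwapRel.swap a b h)

/-- The trace `[A] = [a₁ ⋯ aₙ]` of an independent set `A = {a₁, …, aₙ}`. -/
noncomputable def IndepSet.trace {𝔻 : DependenceAlphabet Γ} (A : 𝔻.IndepSet) : 𝔻.Trace :=
  A.1.noncommProd (fun a => 𝔻.trace [a])
    (fun _ ha _ hb hab => 𝔻.commute_of_indep (A.2 ha hb hab))

/-- The trace `[A₁] ⋯ [Aₙ]` of a word `A₁ ⋯ Aₙ` of independent sets. -/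
noncomputable def foataTrace (W : List 𝔻.IndepSet) : 𝔻.Trace :=
  (W.map IndepSet.trace).prod

/-- The word `A₁ ⋯ Aₙ` is in extended Foata normal form: every letter of `Aᵢ₊₁` depends on some
letter of `Aᵢ`. -/
def IsExtendedFoata (W : List 𝔻.IndepSet) : Prop :=
  W.IsChain (fun A B => ∀ b ∈ B.1, ∃ a ∈ A.1, 𝔻.Dep a b)

/-- The language `L_R` of a binary trace relation `R`, over pairs of independent sets. -/
def foataLanguage (R : Set (𝔻.Trace × 𝔻.Trace)) : Language (𝔻.IndepSet × 𝔻.IndepSet) :=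
  {W | 𝔻.IsExtendedFoata (W.map Prod.fst) ∧ 𝔻.IsExtendedFoata (W.map Prod.snd) ∧
    (𝔻.foataTrace (W.map Prod.fst), 𝔻.foataTrace (W.map Prod.snd)) ∈ R}

/-- A binary trace relation is fnf-automatic if its language `L_R` is regular. -/
def FnfAutomatic (R : Set (𝔻.Trace × 𝔻.Trace)) : Prop :=
  (𝔻.foataLanguage R).IsRegular

/-- The identity relation on traces. -/
def idRel : Set (𝔻.Trace × 𝔻.Trace) := {z | z.1 = z.2}

end DependenceAlphabet

/-! ## Pushdown systems over traces -/

/-- A pushdown system with states `Q` and letters `Γ`; `(p, a, w, q) ∈ Δ` is the transition that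
goes from `p` to `q`, reads `a` and writes `w`. (Finiteness of `Q` and `Γ` is assumed
separately.) -/
@[ext]
structure PushdownSystem (Q Γ : Type*) where
  alph : DependenceAlphabet Γ
  Δ : Set (Q × Γ × List Γ × Q)
  finite_Δ : Δ.Finite

namespace PushdownSystem

variable {Q Γ : Type*} (P : PushdownSystem Q Γ)

/-- The one-step relation on configurations. -/
def Step (c d : Q × P.alph.Trace) : Prop :=
  ∃ (a : Γ) (w x : List Γ), (c.1, a, w, d.1) ∈ P.Δ ∧
    c.2 = P.alph.trace (x ++ [a]) ∧ d.2 = P.alph.trace (x ++ w)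

/-- The reachability relation `reach_{p,q}` on traces. -/
def reach (p q : Q) : Set (P.alph.Trace × P.alph.Trace) :=
  {z | Relation.ReflTransGen P.Step (p, z.1) (q, z.2)}

/-- Trace-pushdown systems. -/
structure IsTPDS : Prop where
  /-- `D(w) ⊆ D(a)` for every transition reading `a` and writing `w`. -/
  dep_subset : ∀ p a w q, (p, a, w, q) ∈ P.Δ →
    ∀ b ∈ w, ∀ c, P.alph.Dep b c → P.alph.Dep a c
  /-- Consecutive transitions reading independent letters can be interchanged. -/
  swap : ∀ p a v q b w r, (p, a, v, q) ∈ P.Δ → (q, b, w, r) ∈ P.Δ → P.alph.Indep a b →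
    ∃ q', (p, b, w, q') ∈ P.Δ ∧ (q', a, v, r) ∈ P.Δ

/-- All transitions write the empty word. -/
def WritesEmpty : Prop := ∀ p a w q, (p, a, w, q) ∈ P.Δ → w = []

end PushdownSystem

/-! ## Finite presentations, for the effectiveness claims -/

/-- A finite description of a pushdown system: the number of states, the number of letters, a list
of pairs of letters, and a list of transitions. -/
abbrev PDSCode : Type :=
  ℕ × ℕ × List (ℕ × ℕ) × List (ℕ × ℕ × List ℕ × ℕ)

namespace PDSCode

/-- The number of states. -/
def states (c : PDSCode) : ℕ := c.1

/-- The number of letters. -/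
def letters (c : PDSCode) : ℕ := c.2.1

/-- The described dependence relation: the reflexive and symmetric closure of the given list. -/
def toAlphabet (c : PDSCode) : DependenceAlphabet (Fin c.letters) where
  Dep a b := a = b ∨ (a.val, b.val) ∈ c.2.2.1 ∨ (b.val, a.val) ∈ c.2.2.1
  refl _ := Or.inl rfl
  symm _ _ h := by
    rcases h with h | h | h
    · exact Or.inl h.symm
    · exact Or.inr (Or.inr h)
    · exact Or.inr (Or.inl h)

/-- The described pushdown system, with states `0, …, c.states - 1` and letters
`0, …, c.letters - 1`. Listed transitions that mention other numbers are ignored. -/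
def toPDS (c : PDSCode) : PushdownSystem (Fin c.states) (Fin c.letters) where
  alph := c.toAlphabet
  Δ := {t | (t.1.val, t.2.1.val, t.2.2.1.map Fin.val, t.2.2.2.val) ∈ c.2.2.2}
  finite_Δ := by
    refine Set.Finite.preimage (f := fun t : Fin c.states × Fin c.letters × List (Fin c.letters) ×
      Fin c.states => (t.1.val, t.2.1.val, t.2.2.1.map Fin.val, t.2.2.2.val)) ?_
      (List.finite_toSet c.2.2.2)
    rintro ⟨p, a, w, q⟩ - ⟨p', a', w', q'⟩ - h
    simp only [Prod.mk.injEq] at h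
    obtain ⟨h1, h2, h3, h4⟩ := h
    rw [Fin.ext h1, Fin.ext h2, Fin.ext h4, List.map_injective_iff.2 Fin.val_injective h3]

/-- Every pushdown system over initial segments of the natural numbers has a description. -/
theorem exists_toPDS_eq {n m : ℕ} (P : PushdownSystem (Fin n) (Fin m)) :
    ∃ (d : List (ℕ × ℕ)) (δ : List (ℕ × ℕ × List ℕ × ℕ)), toPDS (n, m, d, δ) = P := by
  classical
  obtain ⟨⟨Dep, hr, hs⟩, Δ, hΔ⟩ := P
  let d : List (ℕ × ℕ) := ((Finset.univ.filter fun t : Fin m × Fin m => Dep t.1 t.2).image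
    fun t => (t.1.val, t.2.val)).toList
  let δ : List (ℕ × ℕ × List ℕ × ℕ) := (hΔ.toFinset.image
    fun t => (t.1.val, t.2.1.val, t.2.2.1.map Fin.val, t.2.2.2.val)).toList
  have hd : ∀ a b : Fin m, (a.val, b.val) ∈ d ↔ Dep a b := by
    intro a b
    simp only [d, Finset.mem_toList, Finset.mem_image, Finset.mem_filter, Finset.mem_univ,
      true_and, Prod.mk.injEq, Prod.exists]
    constructor
    · rintro ⟨a', b', h, h1, h2⟩
      rwa [← Fin.ext h1, ← Fin.ext h2]
    · exact fun h => ⟨a, b, h, rfl, rfl⟩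
  have hδ : ∀ (p : Fin n) (a : Fin m) (w : List (Fin m)) (q : Fin n),
      (p.val, a.val, w.map Fin.val, q.val) ∈ δ ↔ (p, a, w, q) ∈ Δ := by
    intro p a w q
    simp only [δ, Finset.mem_toList, Finset.mem_image, Set.Finite.mem_toFinset,
      Prod.mk.injEq, Prod.exists]
    constructor
    · rintro ⟨p', a', w', q', h, h1, h2, h3, h4⟩
      rwa [← Fin.ext h1, ← Fin.ext h2, ← Fin.ext h4,
        ← List.map_injective_iff.2 Fin.val_injective h3]
    · exact fun h => ⟨p, a, w, q, h, rfl, rfl, rfl, rfl⟩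
  refine ⟨d, δ, ?_⟩
  have h1 : toAlphabet (n, m, d, δ) = ⟨Dep, hr, hs⟩ := by
    have : ∀ a b : Fin m, (a = b ∨ (a.val, b.val) ∈ d ∨ (b.val, a.val) ∈ d) = Dep a b := by
      intro a b
      rw [hd, hd]
      refine propext ⟨?_, fun h => Or.inr (Or.inl h)⟩
      rintro (rfl | h | h)
      exacts [hr _, h, hs _ _ h]
    exact DependenceAlphabet.ext (funext fun a => funext fun b => this a b)
  exact PushdownSystem.ext h1 (Set.ext fun ⟨p, a, w, q⟩ => hδ p a w q)

end PDSCode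

/-- A finite description of an NFA with letters described by elements of `β`: the number of
states, the list of initial states, the list of transitions, the list of final states. -/
abbrev NFACode (β : Type) : Type :=
  ℕ × List ℕ × List (ℕ × β × ℕ) × List ℕ

namespace NFACode

/-- The described NFA, with states `0, …, c.1 - 1`, where `den b a` says that `b` describes the
letter `a`. -/
def toNFA {α : Type*} {β : Type} (den : β → α → Prop) (c : NFACode β) : NFA α (Fin c.1) where
  start := {s | s.val ∈ c.2.1}
  step s a := {t | ∃ b, den b a ∧ (s.val, b, t.val) ∈ c.2.2.1}
  accept := {s | s.val ∈ c.2.2.2}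

end NFACode

/-- The number `b` describes the letter `b` of `Fin m`. -/
def DenotesLetter {m : ℕ} (b : ℕ) (a : Fin m) : Prop := a.val = b

/-- The pair of lists `b` describes the pair `A` of independent sets if the lists enumerate
them. -/
def DenotesPair {m : ℕ} (𝔻 : DependenceAlphabet (Fin m)) (b : List ℕ × List ℕ)
    (A : 𝔻.IndepSet × 𝔻.IndepSet) : Prop :=
  A.1.1.image Fin.val = b.1.toFinset ∧ A.2.1.image Fin.val = b.2.toFinset

/-! A system that writes nothing can only pop: `(p, s)` reaches `(q, t)` iff `s = t * y` for some
trace `y` that can be popped on the way from `p` to `q` (`mem_reach_iff`). By (P2), whether a word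
can be popped between two given states depends on its trace only (`popPath_iff_of_trace_eq`). So the
set `popSet q p` of these traces serves as K, and the transition graph read backwards is an
automaton for it.

For fnf-automaticity the equation `s = t * y` has to be recognized on normal forms A₁⋯Aₙ of `s` and
B₁⋯Bₙ of `t`, padded at the end by empty sets to equal length. Let letters fall one by one onto a
stack of levels, each coming to rest just above the last level holding a dependent letter. Falls of
independent letters commute, so the resulting profile is an invariant of the trace, and for a word
in extended Foata normal form it is the word itself. Dropping `y` onto the profile of `t` must
therefore give that of `s`. Hence Bᵢ ⊆ Aᵢ, every letter of Cᵢ = Aᵢ \ Bᵢ is independent of Bⱼ for all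
j > i, and y = [C₁]⋯[Cₙ] (`isPrefixPair_and_eq_remainder`). Conversely, these conditions allow all
Cᵢ to be moved to the right, which gives `s = t * y` (`foataTrace_eq_mul_remainder`).

A finite automaton can check this: it remembers the last pair of sets, a set containing all letters
of the Cᵢ so far, and a pushdown state that it moves along [Cᵢ] (`mem_acceptsFrom_reachNFA`). For
effectiveness, both automata are written as primitive recursive functions of the code of the system,
with sets of letters represented by sublists of `List.range`. -/

namespace DependenceAlphabet

variable {Γ : Type*} {𝔻 : DependenceAlphabet Γ}

/-! ### Words and their traces -/

theorem trace_nil : 𝔻.trace [] = 1 := rfl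

theorem trace_append (u v : List Γ) : 𝔻.trace (u ++ v) = 𝔻.trace u * 𝔻.trace v :=
  map_mul (PresentedMonoid.mk 𝔻.SwapRel) (FreeMonoid.ofList u) (FreeMonoid.ofList v)

theorem trace_cons (a : Γ) (v : List Γ) : 𝔻.trace (a :: v) = 𝔻.trace [a] * 𝔻.trace v :=
  trace_append [a] v

theorem trace_surjective : Function.Surjective 𝔻.trace := fun t => by
  obtain ⟨w, rfl⟩ := PresentedMonoid.surjective_mk t
  exact ⟨FreeMonoid.toList w, rfl⟩

theorem trace_eq_prod (w : List Γ) : 𝔻.trace w = (w.map fun a => 𝔻.trace [a]).prod := by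
  induction w with
  | nil => rfl
  | cons a w ih => rw [trace_cons, ih, List.map_cons, List.prod_cons]

theorem Indep.symm {a b : Γ} (h : 𝔻.Indep a b) : 𝔻.Indep b a :=
  ⟨h.1.symm, fun h' => h.2 (𝔻.symm _ _ h')⟩

theorem indep_of_not_dep {a b : Γ} (h : ¬ 𝔻.Dep a b) : 𝔻.Indep a b :=
  ⟨fun e => h (e ▸ 𝔻.refl a), h⟩

/-- Words with the same trace are identified by every congruence that lets independent letters
commute. -/
theorem con_of_trace_eq (c : Con (FreeMonoid Γ))
    (hc : ∀ a b, 𝔻.Indep a b →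
      c (FreeMonoid.of a * FreeMonoid.of b) (FreeMonoid.of b * FreeMonoid.of a))
    {u v : List Γ} (h : 𝔻.trace u = 𝔻.trace v) :
    c (FreeMonoid.ofList u) (FreeMonoid.ofList v) := by
  have h' : conGen 𝔻.SwapRel (FreeMonoid.ofList u) (FreeMonoid.ofList v) := (Con.eq _).1 h
  refine Con.conGen_le.2 ?_ h'
  rintro _ _ ⟨a, b, hab⟩
  exact hc a b hab

/-- A fold whose steps commute for independent letters depends on the trace only. -/
theorem foldl_eq_of_trace_eq {X : Type*} (f : X → Γ → X)
    (hf : ∀ a b, 𝔻.Indep a b → ∀ x, f (f x a) b = f (f x b) a)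
    {u v : List Γ} (h : 𝔻.trace u = 𝔻.trace v) (x : X) : u.foldl f x = v.foldl f x := by
  let c : Con (FreeMonoid Γ) :=
    { r := fun u v => ∀ x, (FreeMonoid.toList u).foldl f x = (FreeMonoid.toList v).foldl f x
      iseqv := ⟨fun _ _ => rfl, fun h x => (h x).symm, fun h h' x => (h x).trans (h' x)⟩
      mul' := fun h h' x => by
        simp only [FreeMonoid.toList_mul, List.foldl_append]
        rw [h, h'] }
  exact con_of_trace_eq c (fun a b hab x => hf a b hab x) h x

theorem commute_trace {u v : List Γ} (h : ∀ a ∈ u, ∀ b ∈ v, 𝔻.Indep a b) :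
    Commute (𝔻.trace u) (𝔻.trace v) := by
  rw [trace_eq_prod u, trace_eq_prod v]
  refine Commute.list_prod_left _ _ fun x hx => Commute.list_prod_right _ _ fun y hy => ?_
  obtain ⟨a, ha, rfl⟩ := List.mem_map.1 hx
  obtain ⟨b, hb, rfl⟩ := List.mem_map.1 hy
  exact 𝔻.commute_of_indep (h a ha b hb)

theorem trace_eq_of_perm {u v : List Γ} (h : u.Perm v) (hu : u.Pairwise 𝔻.Indep) :
    𝔻.trace u = 𝔻.trace v := by
  rw [trace_eq_prod u, trace_eq_prod v]
  refine (h.map _).prod_eq' ?_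
  rw [List.pairwise_map]
  exact hu.imp fun h => 𝔻.commute_of_indep h

theorem trace_eq_of_mem_iff {u v : List Γ} (hu : u.Nodup) (hv : v.Nodup)
    (h : ∀ a, a ∈ u ↔ a ∈ v) (hI : ∀ a ∈ u, ∀ b ∈ u, a ≠ b → 𝔻.Indep a b) :
    𝔻.trace u = 𝔻.trace v :=
  trace_eq_of_perm ((List.perm_ext_iff_of_nodup hu hv).2 h)
    (List.Pairwise.imp_of_mem (fun ha hb hab => hI _ ha _ hb hab) hu)

theorem IndepSet.trace_eq (A : 𝔻.IndepSet) : A.trace = 𝔻.trace A.1.toList := by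
  classical
  rw [trace_eq_prod]
  unfold IndepSet.trace
  rw [← Finset.noncommProd_toFinset _ _ _ A.1.nodup_toList]
  · congr 1
    exact (Finset.toList_toFinset _).symm
  · intro a ha b hb hab
    exact 𝔻.commute_of_indep (A.2 (by simpa using ha) (by simpa using hb) hab)

open Classical in
/-- The trace of the letters of `A` that are not in `B`, in some order. -/
noncomputable def diffTrace (𝔻 : DependenceAlphabet Γ) (A B : Finset Γ) : 𝔻.Trace :=
  𝔻.trace (A.filter (· ∉ B)).toList

theorem trace_eq_diffTrace {A B : Finset Γ} (hA : (A : Set Γ).Pairwise 𝔻.Indep) {u : List Γ}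
    (hu : u.Nodup) (h : ∀ a, a ∈ u ↔ a ∈ A ∧ a ∉ B) : 𝔻.trace u = 𝔻.diffTrace A B := by
  classical
  refine trace_eq_of_mem_iff hu (Finset.nodup_toList _) (fun a => by simp [h]) ?_
  intro a ha b hb hab
  exact hA ((h a).1 ha).1 ((h b).1 hb).1 hab

theorem diffTrace_self (A : Finset Γ) : 𝔻.diffTrace A A = 1 := by
  classical
  have : A.filter (· ∉ A) = ∅ := by ext; simp
  rw [diffTrace, this, Finset.toList_empty, trace_nil]

theorem commute_diffTrace {A B : Finset Γ} {u : List Γ}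
    (h : ∀ a ∈ A, a ∉ B → ∀ b ∈ u, ¬ 𝔻.Dep a b) : Commute (𝔻.diffTrace A B) (𝔻.trace u) := by
  classical
  refine commute_trace fun a ha b hb => indep_of_not_dep ?_
  simp only [Finset.mem_toList, Finset.mem_filter] at ha
  exact h a ha.1 ha.2 b hb

theorem IndepSet.trace_eq_mul_diffTrace {A B : 𝔻.IndepSet} (h : B.1 ⊆ A.1) :
    A.trace = B.trace * 𝔻.diffTrace A.1 B.1 := by
  classical
  rw [A.trace_eq, B.trace_eq, diffTrace, ← trace_append]
  refine trace_eq_of_mem_iff A.1.nodup_toList ?_ ?_ ?_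
  · refine List.nodup_append.2 ⟨B.1.nodup_toList, Finset.nodup_toList _, ?_⟩
    rintro a ha b hb rfl
    simp only [Finset.mem_toList, Finset.mem_filter] at ha hb
    exact hb.2 ha
  · intro a
    simp only [Finset.mem_toList, List.mem_append, Finset.mem_filter]
    have := @h a
    tauto
  · intro a ha b hb hab
    exact A.2 (by simpa using ha) (by simpa using hb) hab

/-! ### Profiles: the placement of letters into levels -/

/-- The first level such that neither it nor any later level holds a letter dependent on `a`. -/
noncomputable def level (𝔻 : DependenceAlphabet Γ) (F : ℕ → Finset Γ) (a : Γ) : ℕ :=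
  sInf {i | ∀ j ≥ i, ∀ b ∈ F j, ¬ 𝔻.Dep b a}

open Classical in
/-- The profile obtained by adding the letter `a` at the first possible level. -/
noncomputable def place (𝔻 : DependenceAlphabet Γ) (F : ℕ → Finset Γ) (a : Γ) : ℕ → Finset Γ :=
  Function.update F (𝔻.level F a) (insert a (F (𝔻.level F a)))

theorem mem_place {F : ℕ → Finset Γ} {a c : Γ} {j : ℕ} :
    c ∈ 𝔻.place F a j ↔ c ∈ F j ∨ (j = 𝔻.level F a ∧ c = a) := by
  unfold place
  by_cases h : j = 𝔻.level F a
  · subst h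
    simp [or_comm]
  · simp [h]

/-- An independent letter never blocks `a`, so both infima are over the same set of levels. This
covers the default value of `sInf` too, so `place_comm` holds for arbitrary profiles, as
`foldl_eq_of_trace_eq` demands. -/
theorem level_place {F : ℕ → Finset Γ} {a b : Γ} (h : 𝔻.Indep a b) :
    𝔻.level (𝔻.place F b) a = 𝔻.level F a := by
  unfold level
  congr 1
  ext i
  refine forall₂_congr fun j _ => ?_
  simp only [mem_place]
  constructor
  · exact fun H c hc => H c (Or.inl hc)
  · rintro H c (hc | ⟨-, rfl⟩)
    exacts [H c hc, h.symm.2]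

theorem place_comm {a b : Γ} (h : 𝔻.Indep a b) (F : ℕ → Finset Γ) :
    𝔻.place (𝔻.place F a) b = 𝔻.place (𝔻.place F b) a := by
  funext j
  ext c
  simp only [mem_place, level_place h, level_place h.symm]
  tauto

theorem level_eq {F : ℕ → Finset Γ} {a : Γ} {n : ℕ} (h : ∀ j ≥ n, ∀ b ∈ F j, ¬ 𝔻.Dep b a)
    (h' : n = 0 ∨ ∃ b ∈ F (n - 1), 𝔻.Dep b a) : 𝔻.level F a = n := by
  refine le_antisymm (Nat.sInf_le h) (le_csInf ⟨n, h⟩ fun i hi => ?_)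
  rcases h' with rfl | ⟨b, hb, hd⟩
  · exact Nat.zero_le _
  · by_contra hlt
    exact hi (n - 1) (by omega) b hb hd

theorem not_dep_of_level_le {F : ℕ → Finset Γ} (hF : ∃ N, ∀ i ≥ N, F i = ∅) {a : Γ} {j : ℕ}
    (hj : 𝔻.level F a ≤ j) {b : Γ} (hb : b ∈ F j) : ¬ 𝔻.Dep b a := by
  obtain ⟨N, hN⟩ := hF
  have : 𝔻.level F a ∈ {i | ∀ j ≥ i, ∀ b ∈ F j, ¬ 𝔻.Dep b a} :=
    Nat.sInf_mem ⟨N, fun j hj b hb => by simp [hN j hj] at hb⟩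
  exact this j hj b hb

/-- Each letter of `l` comes to rest exactly on level `n`: from there on it meets only other letters
of `l`, which are independent of it, and level `n - 1`, if there is one, stops it. -/
theorem mem_foldl_place_of_layer {F : ℕ → Finset Γ} {n : ℕ} (hF : ∀ j ≥ n, F j = ∅) {l : List Γ}
    (hl : l.Pairwise 𝔻.Indep) (hd : ∀ a ∈ l, n = 0 ∨ ∃ b ∈ F (n - 1), 𝔻.Dep b a)
    {c : Γ} {j : ℕ} : c ∈ l.foldl 𝔻.place F j ↔ c ∈ F j ∨ (j = n ∧ c ∈ l) := by
  induction l using List.reverseRecOn generalizing c j with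
  | nil => simp
  | append_singleton l a ih =>
    rw [List.pairwise_append] at hl
    replace ih := @ih hl.1 fun b hb => hd b (by simp [hb])
    have hlev : 𝔻.level (l.foldl 𝔻.place F) a = n := by
      refine level_eq (fun j hj b hb => ?_) ?_
      · rw [ih, hF j hj] at hb
        rcases hb with hb | ⟨-, hb⟩
        · simp at hb
        · exact (hl.2.2 b hb a (by simp)).2
      · refine (hd a (by simp)).imp_right fun ⟨b, hb, hba⟩ => ⟨b, ih.2 (Or.inl hb), hba⟩
    rw [List.foldl_append, List.foldl_cons, List.foldl_nil, mem_place, ih, hlev]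
    simp only [List.mem_append, List.mem_singleton]
    tauto

/-- The profile whose levels are the entries of `W`. -/
def layers (W : List 𝔻.IndepSet) (i : ℕ) : Finset Γ := (W.map Subtype.val).getD i ∅

theorem layers_eq_empty {W : List 𝔻.IndepSet} {i : ℕ} (h : W.length ≤ i) : layers W i = ∅ := by
  simp [layers, h]

theorem layers_of_lt {W : List 𝔻.IndepSet} {i : ℕ} (h : i < W.length) :
    layers W i = (W[i]).1 := by
  simp [layers, h]

theorem pairwise_layers (W : List 𝔻.IndepSet) (i : ℕ) :
    (layers W i : Set Γ).Pairwise 𝔻.Indep := by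
  rcases lt_or_ge i W.length with h | h
  · rw [layers_of_lt h]
    exact (W[i]).2
  · simp [layers_eq_empty h]

/-- A word representing `[A₁] ⋯ [Aₙ]`. -/
noncomputable def foataWord (W : List 𝔻.IndepSet) : List Γ := W.flatMap fun A => A.1.toList

theorem trace_foataWord (W : List 𝔻.IndepSet) : 𝔻.trace (foataWord W) = 𝔻.foataTrace W := by
  induction W with
  | nil => rfl
  | cons A W ih =>
    rw [foataWord, List.flatMap_cons, trace_append, ← IndepSet.trace_eq]
    change _ * 𝔻.trace (foataWord W) = _
    rw [ih]
    simp [foataTrace]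

theorem foldl_place_foataWord {W : List 𝔻.IndepSet} (hW : 𝔻.IsExtendedFoata W) :
    (foataWord W).foldl 𝔻.place (fun _ => ∅) = layers W := by
  induction W using List.reverseRecOn with
  | nil => funext i; simp [foataWord, layers]
  | append_singleton W A ih =>
    have hW' := List.isChain_append.1 hW
    have hword : foataWord (W ++ [A]) = foataWord W ++ A.1.toList := by simp [foataWord]
    funext j
    ext c
    rw [hword, List.foldl_append, ih hW'.1,
      mem_foldl_place_of_layer (n := W.length) (fun j hj => layers_eq_empty hj)]
    · rcases lt_trichotomy j W.length with h | rfl | h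
      · rw [layers_of_lt h, layers_of_lt (by simp; omega)]
        simp [List.getElem_append_left h, h.ne]
      · rw [layers_eq_empty le_rfl, layers_of_lt (by simp)]
        simp
      · rw [layers_eq_empty h.le, layers_eq_empty (by simp; omega)]
        simp [h.ne']
    · exact List.Pairwise.imp_of_mem
        (fun ha hb hab => A.2 (by simpa using ha) (by simpa using hb) hab) A.1.nodup_toList
    · intro a ha
      rcases Nat.eq_zero_or_pos W.length with h0 | h0
      · exact Or.inl h0
      · right
        have hne : W ≠ [] := List.length_pos_iff.1 h0
        obtain ⟨b, hb, hba⟩ := hW'.2.2 (W.getLast hne)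
          (by simp [List.getLast?_eq_getLast_of_ne_nil hne]) A (by simp) a (by simpa using ha)
        refine ⟨b, ?_, hba⟩
        rw [layers_of_lt (by omega)]
        rwa [List.getLast_eq_getElem] at hb

/-- Uniqueness of the normal form, up to trailing empty sets: the profile can be computed from any
word for the trace. -/
theorem foldl_place_eq_layers {W : List 𝔻.IndepSet} (hW : 𝔻.IsExtendedFoata W) {w : List Γ}
    (h : 𝔻.trace w = 𝔻.foataTrace W) : w.foldl 𝔻.place (fun _ => ∅) = layers W := by
  rw [← foldl_place_foataWord hW]
  exact foldl_eq_of_trace_eq 𝔻.place (fun a b hab F => place_comm hab F)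
    (h.trans (trace_foataWord W).symm) _

/-- A factor appended on the right moves left past the factors it commutes with and is absorbed at
index `l`. -/
theorem prod_map_range_mul {M : Type*} [Monoid M] {g g' : ℕ → M} {t : M} {l N : ℕ} (hl : l < N)
    (hne : ∀ i, i ≠ l → g' i = g i) (heq : g' l = g l * t) (hc : ∀ i, l < i → Commute (g i) t) :
    ((List.range N).map g').prod = ((List.range N).map g).prod * t := by
  induction N with
  | zero => omega
  | succ N ih =>
    simp only [List.range_succ, List.map_append, List.map_cons, List.map_nil, List.prod_append,
      List.prod_singleton]
    rcases Nat.lt_succ_iff_lt_or_eq.1 hl with h | rfl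
    · rw [ih h, hne N h.ne', mul_assoc, mul_assoc, (hc N h).eq]
    · have : (List.range l).map g' = (List.range l).map g :=
        List.map_congr_left fun i hi => hne i (List.mem_range.1 hi).ne
      rw [this, heq, mul_assoc]

/-- Reading a word `w` from the profile `B` adds letters to the levels of `B`; the added letters
are independent of the letters of `B` on later levels, and level by level they represent `[w]`. -/
theorem foldl_place_spec {B : ℕ → Finset Γ} (hB : ∀ i, (B i : Set Γ).Pairwise 𝔻.Indep)
    (hfin : ∃ N, ∀ i ≥ N, B i = ∅) (w : List Γ) :
    (∀ i, B i ⊆ w.foldl 𝔻.place B i) ∧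
    (∀ i, (w.foldl 𝔻.place B i : Set Γ).Pairwise 𝔻.Indep) ∧
    (∀ i j, i < j → ∀ c ∈ w.foldl 𝔻.place B i, c ∉ B i → ∀ b ∈ B j, ¬ 𝔻.Dep c b) ∧
    (∃ N, ∀ i ≥ N, w.foldl 𝔻.place B i = ∅) ∧
    ∀ N, (∀ i ≥ N, w.foldl 𝔻.place B i = ∅) →
      𝔻.trace w =
        ((List.range N).map fun i => 𝔻.diffTrace (w.foldl 𝔻.place B i) (B i)).prod := by
  classical
  induction w using List.reverseRecOn with
  | nil =>
    refine ⟨fun i => subset_rfl, hB, fun i j _ c hc hc' => absurd hc hc', hfin, fun N _ => ?_⟩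
    simp [diffTrace_self, trace_nil]
  | append_singleton w a ih =>
    obtain ⟨h1, h2, h3, h4, h5⟩ := ih
    simp only [List.foldl_append, List.foldl_cons, List.foldl_nil]
    set F := w.foldl 𝔻.place B with hF
    have hnd : ∀ {j}, 𝔻.level F a ≤ j → ∀ {b}, b ∈ F j → ¬ 𝔻.Dep b a :=
      fun hj _ hb => not_dep_of_level_le h4 hj hb
    have hind : ∀ i, (𝔻.place F a i : Set Γ).Pairwise 𝔻.Indep := by
      intro i b hb c hc hbc
      rw [Finset.mem_coe, mem_place] at hb hc
      rcases hb with hb | ⟨rfl, rfl⟩ <;> rcases hc with hc | ⟨hi, rfl⟩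
      · exact h2 i hb hc hbc
      · exact indep_of_not_dep (hnd hi.ge hb)
      · exact (indep_of_not_dep (hnd le_rfl hc)).symm
      · exact absurd rfl hbc
    refine ⟨fun i c hc => mem_place.2 (Or.inl (h1 i hc)), hind, ?_, ?_, ?_⟩
    · intro i j hij c hc hcB b hb hdep
      rcases mem_place.1 hc with hc | ⟨rfl, rfl⟩
      · exact h3 i j hij c hc hcB b hb hdep
      · exact hnd hij.le (h1 j hb) (𝔻.symm _ _ hdep)
    · obtain ⟨N, hN⟩ := h4
      refine ⟨max N (𝔻.level F a + 1), fun i hi => Finset.eq_empty_of_forall_notMem fun c hc => ?_⟩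
      rcases mem_place.1 hc with hc | ⟨rfl, -⟩
      · simp [hN i (le_of_max_le_left hi)] at hc
      · have := le_of_max_le_right hi
        omega
    · intro N hN
      have hlN : 𝔻.level F a < N := by
        by_contra h
        have : a ∈ 𝔻.place F a (𝔻.level F a) := mem_place.2 (Or.inr ⟨rfl, rfl⟩)
        simp [hN _ (not_lt.1 h)] at this
      have haF : a ∉ F (𝔻.level F a) := fun h => hnd le_rfl h (𝔻.refl a)
      rw [trace_append, h5 N fun i hi => Finset.eq_empty_of_forall_notMem fun c hc => by
        simpa [hN i hi] using (mem_place (𝔻 := 𝔻) (a := a)).2 (Or.inl hc)]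
      -- Only the factor of the level where `a` lands changes; all later levels are independent of
      -- `a` by the choice of that level.
      refine (prod_map_range_mul hlN (fun i hi => ?_) ?_ fun i hi => ?_).symm
      · have : 𝔻.place F a i = F i := by
          ext c
          simp [mem_place, hi]
        rw [this]
      · conv_rhs => rw [diffTrace, ← trace_append]
        refine (trace_eq_diffTrace (hind _) ?_ fun c => ?_).symm
        · refine List.nodup_append.2 ⟨Finset.nodup_toList _, by simp, ?_⟩
          simp only [Finset.mem_toList, Finset.mem_filter, List.mem_singleton]
          rintro b ⟨hb, -⟩ _ rfl rfl
          exact haF hb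
        · have := @h1 (𝔻.level F a) a
          simp only [List.mem_append, Finset.mem_toList, Finset.mem_filter, List.mem_singleton,
            mem_place, true_and]
          constructor
          · rintro (h | rfl)
            · exact ⟨Or.inl h.1, h.2⟩
            · exact ⟨Or.inr rfl, fun h => haF (this h)⟩
          · rintro ⟨h | h, h'⟩
            exacts [Or.inl ⟨h, h'⟩, Or.inr h]
      · refine commute_diffTrace fun b hb _ c hc => ?_
        rw [List.mem_singleton] at hc
        subst hc
        exact hnd hi.le hb

end DependenceAlphabet

/-! ### Nondeterministic automata: acceptance from single states, and transfer along surjections. -/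

namespace NFA

variable {α σ τ : Type*}

theorem mem_acceptsFrom_iff_exists {M : NFA α σ} {S : Set σ} {w : List α} :
    w ∈ M.acceptsFrom S ↔ ∃ s ∈ S, w ∈ M.acceptsFrom {s} := by
  simp only [mem_acceptsFrom, mem_evalFrom_iff_exists (S := S)]
  constructor
  · rintro ⟨u, hu, t, ht, h⟩
    exact ⟨t, ht, u, hu, h⟩
  · rintro ⟨t, ht, u, hu, h⟩
    exact ⟨u, hu, t, ht, h⟩

theorem cons_mem_acceptsFrom_singleton {M : NFA α σ} {s : σ} {a : α} {w : List α} :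
    a :: w ∈ M.acceptsFrom {s} ↔ ∃ t ∈ M.step s a, w ∈ M.acceptsFrom {t} := by
  rw [cons_mem_acceptsFrom, stepSet_singleton, mem_acceptsFrom_iff_exists]

theorem isRegular_accepts [Finite σ] (M : NFA α σ) : M.accepts.IsRegular := by
  have := Fintype.ofFinite (Set σ)
  exact Language.isRegular_iff.2 ⟨Set σ, inferInstance, M.toDFA, M.toDFA_correct⟩

/-- A surjection that preserves and reflects all the data of an automaton preserves its
language. -/
theorem accepts_eq_of_surjective {M : NFA α σ} {M' : NFA α τ} (f : σ → τ)
    (hf : Function.Surjective f) (hstart : ∀ x, x ∈ M.start ↔ f x ∈ M'.start)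
    (hstep : ∀ x a y, y ∈ M.step x a ↔ f y ∈ M'.step (f x) a)
    (haccept : ∀ x, x ∈ M.accept ↔ f x ∈ M'.accept) : M.accepts = M'.accepts := by
  have key : ∀ w x, w ∈ M.acceptsFrom {x} ↔ w ∈ M'.acceptsFrom {f x} := by
    intro w
    induction w with
    | nil => simp [nil_mem_acceptsFrom, haccept]
    | cons a w ih =>
      intro x
      simp only [cons_mem_acceptsFrom_singleton, hf.exists, hstep, ih]
  ext w
  rw [accepts_eq_acceptsFrom_start, accepts_eq_acceptsFrom_start, mem_acceptsFrom_iff_exists,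
    mem_acceptsFrom_iff_exists (M := M')]
  simp only [hf.exists, hstart, key]

end NFA

namespace DependenceAlphabet

variable {Γ : Type*} {𝔻 : DependenceAlphabet Γ}

/-! ### Prefixes in extended Foata normal form -/

/-- In each pair the second set is contained in the first, and the letters missing in it are
independent of the second sets of all later pairs. -/
def IsPrefixPair (W : List (𝔻.IndepSet × 𝔻.IndepSet)) : Prop :=
  (∀ x ∈ W, x.2.1 ⊆ x.1.1) ∧
    W.Pairwise fun x y => ∀ c ∈ x.1.1, c ∉ x.2.1 → ∀ b ∈ y.2.1, ¬ 𝔻.Dep c b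

/-- The trace of all the letters missing in the second sets. -/
noncomputable def remainder (W : List (𝔻.IndepSet × 𝔻.IndepSet)) : 𝔻.Trace :=
  (W.map fun x => 𝔻.diffTrace x.1.1 x.2.1).prod

/-- The letters missing in the first pair commute with the second sets of all later pairs and can be
moved behind them. -/
theorem foataTrace_eq_mul_remainder {W : List (𝔻.IndepSet × 𝔻.IndepSet)} (hW : IsPrefixPair W) :
    𝔻.foataTrace (W.map Prod.fst) = 𝔻.foataTrace (W.map Prod.snd) * remainder W := by
  induction W with
  | nil => simp [foataTrace, remainder]
  | cons x W ih =>
    obtain ⟨h1, h2⟩ := hW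
    rw [List.pairwise_cons] at h2
    have hW' := ih ⟨fun y hy => h1 y (by simp [hy]), h2.2⟩
    have hc : Commute (𝔻.diffTrace x.1.1 x.2.1) (𝔻.foataTrace (W.map Prod.snd)) := by
      rw [← trace_foataWord]
      refine commute_diffTrace fun c hc hc' b hb => ?_
      simp only [foataWord, List.mem_flatMap, List.mem_map, Finset.mem_toList] at hb
      obtain ⟨_, ⟨y, hy, rfl⟩, hb⟩ := hb
      exact h2.1 y hy c hc hc' b hb
    change x.1.trace * 𝔻.foataTrace (W.map Prod.fst) =
      x.2.trace * 𝔻.foataTrace (W.map Prod.snd) * (𝔻.diffTrace x.1.1 x.2.1 * remainder W)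
    rw [hW', IndepSet.trace_eq_mul_diffTrace (h1 x (by simp))]
    simp only [mul_assoc]
    rw [← mul_assoc (𝔻.diffTrace _ _), hc.eq, mul_assoc]

/-- Dropping a word for `y` onto the profile of the second component yields the profile of the
first, so `foldl_place_spec` applies to these two profiles. -/
theorem isPrefixPair_and_eq_remainder {W : List (𝔻.IndepSet × 𝔻.IndepSet)}
    (hfst : 𝔻.IsExtendedFoata (W.map Prod.fst)) (hsnd : 𝔻.IsExtendedFoata (W.map Prod.snd))
    {y : 𝔻.Trace} (h : 𝔻.foataTrace (W.map Prod.fst) = 𝔻.foataTrace (W.map Prod.snd) * y) :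
    IsPrefixPair W ∧ y = remainder W := by
  obtain ⟨w, rfl⟩ := trace_surjective y
  have hF : w.foldl 𝔻.place (layers (W.map Prod.snd)) = layers (W.map Prod.fst) := by
    rw [← foldl_place_foataWord hsnd, ← List.foldl_append]
    refine foldl_place_eq_layers hfst ?_
    rw [trace_append, trace_foataWord, h]
  obtain ⟨h1, -, h3, -, h5⟩ := foldl_place_spec (pairwise_layers (W.map Prod.snd))
    ⟨_, fun i hi => layers_eq_empty hi⟩ w
  rw [hF] at h1 h3 h5
  have hfst' : ∀ i (hi : i < W.length), layers (W.map Prod.fst) i = (W[i]).1.1 := fun i hi => by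
    rw [layers_of_lt (by simpa using hi)]
    simp
  have hsnd' : ∀ i (hi : i < W.length), layers (W.map Prod.snd) i = (W[i]).2.1 := fun i hi => by
    rw [layers_of_lt (by simpa using hi)]
    simp
  refine ⟨⟨fun x hx => ?_, ?_⟩, ?_⟩
  · obtain ⟨i, hi, rfl⟩ := List.getElem_of_mem hx
    simpa only [hfst' i hi, hsnd' i hi] using h1 i
  · refine List.pairwise_iff_getElem.2 fun i j hi hj hij => ?_
    simpa only [hfst' i hi, hsnd' i hi, hsnd' j hj] using h3 i j hij
  · rw [h5 W.length fun i hi => layers_eq_empty (by simpa using hi), remainder]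
    congr 1
    refine List.ext_getElem (by simp) fun i hi _ => ?_
    have hi' : i < W.length := by simpa using hi
    simp [hfst' i hi', hsnd' i hi']

end DependenceAlphabet

namespace PushdownSystem

open DependenceAlphabet

variable {Q Γ : Type*} {P : PushdownSystem Q Γ}

/-! ### Sequences of popping transitions -/

/-- `P.PopPath s w t`: the transitions that write the empty word lead from `t` to `s` while
removing `w` from right to left. -/
def PopPath (P : PushdownSystem Q Γ) : Q → List Γ → Q → Prop
  | s, [], t => s = t
  | s, a :: w, t => ∃ r, (r, a, [], s) ∈ P.Δ ∧ P.PopPath r w t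

theorem popPath_append {s t : Q} {u v : List Γ} :
    P.PopPath s (u ++ v) t ↔ ∃ r, P.PopPath s u r ∧ P.PopPath r v t := by
  induction u generalizing s with
  | nil => simp [PopPath]
  | cons a u ih =>
    simp only [List.cons_append, PopPath, ih]
    constructor
    · rintro ⟨r, h, r', h', h''⟩
      exact ⟨r', ⟨r, h, h'⟩, h''⟩
    · rintro ⟨r', ⟨r, h, h'⟩, h''⟩
      exact ⟨r, h, r', h', h''⟩

/-- Being poppable between the same pairs of states is a congruence on words, and (P2) puts the
generating swaps into it. -/
theorem popPath_iff_of_trace_eq (hP : P.IsTPDS) {u v : List Γ}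
    (h : P.alph.trace u = P.alph.trace v) (s t : Q) : P.PopPath s u t ↔ P.PopPath s v t := by
  let c : Con (FreeMonoid Γ) :=
    { r := fun u v => ∀ s t,
        P.PopPath s (FreeMonoid.toList u) t ↔ P.PopPath s (FreeMonoid.toList v) t
      iseqv := ⟨fun _ _ _ => Iff.rfl, fun h s t => (h s t).symm,
        fun h h' s t => (h s t).trans (h' s t)⟩
      mul' := fun h h' s t => by
        simp only [FreeMonoid.toList_mul, popPath_append, h, h'] }
  have key : ∀ a b, P.alph.Indep a b → ∀ s t, P.PopPath s [a, b] t → P.PopPath s [b, a] t := by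
    rintro a b hab s t ⟨r, h1, r', h2, rfl⟩
    obtain ⟨q', h3, h4⟩ := hP.swap _ _ _ _ _ _ _ h2 h1 hab.symm
    exact ⟨q', h4, r', h3, rfl⟩
  exact con_of_trace_eq c (fun a b hab s t => ⟨key a b hab s t, key b a hab.symm s t⟩) h s t

/-- The set of traces that can be popped on the way from `t` to `s`. -/
def popSet (P : PushdownSystem Q Γ) (s t : Q) : Set P.alph.Trace :=
  {y | ∃ w, P.alph.trace w = y ∧ P.PopPath s w t}

theorem trace_mem_popSet (hP : P.IsTPDS) {s t : Q} {w : List Γ} :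
    P.alph.trace w ∈ P.popSet s t ↔ P.PopPath s w t :=
  ⟨fun ⟨_, h, h'⟩ => (popPath_iff_of_trace_eq hP h s t).1 h', fun h => ⟨w, rfl, h⟩⟩

theorem one_mem_popSet (hP : P.IsTPDS) {s t : Q} : 1 ∈ P.popSet s t ↔ s = t :=
  trace_mem_popSet hP (w := [])

/-- This lets the automaton process the remainder factor by factor, keeping only an intermediate
state. -/
theorem mul_mem_popSet (hP : P.IsTPDS) {s t : Q} {x y : P.alph.Trace} :
    x * y ∈ P.popSet s t ↔ ∃ r, x ∈ P.popSet s r ∧ y ∈ P.popSet r t := by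
  obtain ⟨u, rfl⟩ := trace_surjective x
  obtain ⟨v, rfl⟩ := trace_surjective y
  simp only [← trace_append, trace_mem_popSet hP, popPath_append]

theorem mem_reach_iff (hP : P.IsTPDS) (hE : P.WritesEmpty) {p q : Q} {s t : P.alph.Trace} :
    (s, t) ∈ P.reach p q ↔ ∃ y ∈ P.popSet q p, s = t * y := by
  constructor
  · have key : ∀ c d : Q × P.alph.Trace, Relation.ReflTransGen P.Step c d →
        ∃ y ∈ P.popSet d.1 c.1, c.2 = d.2 * y := by
      intro c d h
      induction h using Relation.ReflTransGen.head_induction_on with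
      | refl => exact ⟨1, (one_mem_popSet hP).2 rfl, (mul_one _).symm⟩
      | head h _ ih =>
        obtain ⟨y, hy, e⟩ := ih
        obtain ⟨a, w, x, hΔ, e1, e2⟩ := h
        obtain rfl := hE _ _ _ _ hΔ
        refine ⟨y * P.alph.trace [a],
          (mul_mem_popSet hP).2 ⟨_, hy, (trace_mem_popSet hP).2 ⟨_, hΔ, rfl⟩⟩, ?_⟩
        rw [e1, trace_append, ← mul_assoc, ← e, e2, List.append_nil]
    exact key _ _
  · rintro ⟨_, ⟨w, rfl, hw⟩, rfl⟩
    induction w generalizing q t with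
    | nil =>
      obtain rfl : q = p := hw
      rw [trace_nil, mul_one]
      exact Relation.ReflTransGen.refl
    | cons a w ih =>
      obtain ⟨r, hr, hw⟩ := hw
      obtain ⟨x, rfl⟩ := trace_surjective t
      -- Popping goes from right to left, so `w` is removed while `a` is still on top of `x`.
      have := ih (t := P.alph.trace (x ++ [a])) hw
      rw [trace_append, mul_assoc, ← trace_cons] at this
      refine Relation.ReflTransGen.tail this ⟨a, [], x, hr, trace_append _ _, ?_⟩
      rw [List.append_nil]

theorem reach_eq (hP : P.IsTPDS) (hE : P.WritesEmpty) (p q : Q) :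
    P.reach p q = P.alph.idRel * (P.popSet q p ×ˢ {1}) := by
  ext ⟨s, t⟩
  rw [mem_reach_iff hP hE, Set.mem_mul]
  constructor
  · rintro ⟨y, hy, rfl⟩
    exact ⟨(t, t), rfl, (y, 1), ⟨hy, rfl⟩, by simp⟩
  · rintro ⟨⟨x, x'⟩, hx, ⟨y, z⟩, ⟨hy, hz⟩, e⟩
    obtain rfl : x = x' := hx
    obtain rfl : z = 1 := hz
    simp only [Prod.mk_mul_mk, mul_one, Prod.mk.injEq] at e
    exact ⟨y, hy, by rw [← e.1, ← e.2]⟩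

/-- The automaton reading the popped words from left to right. -/
def popNFA (P : PushdownSystem Q Γ) (p q : Q) : NFA Γ Q where
  start := {q}
  step s a := {r | (r, a, [], s) ∈ P.Δ}
  accept := {p}

theorem mem_evalFrom_popNFA {p q t : Q} {X : Set Q} {w : List Γ} :
    t ∈ (P.popNFA p q).evalFrom X w ↔ ∃ s ∈ X, P.PopPath s w t := by
  induction w generalizing X with
  | nil => simp [PopPath]
  | cons a w ih =>
    rw [NFA.evalFrom_cons, ih]
    simp only [NFA.mem_stepSet, PopPath]
    constructor
    · rintro ⟨r, ⟨s, hs, h⟩, h'⟩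
      exact ⟨s, hs, r, h, h'⟩
    · rintro ⟨s, hs, r, h, h'⟩
      exact ⟨r, ⟨s, hs, h⟩, h'⟩

theorem accepts_popNFA (hP : P.IsTPDS) (p q : Q) :
    (P.popNFA p q).accepts = ({w | P.alph.trace w ∈ P.popSet q p} : Language Γ) := by
  ext w
  change (∃ t ∈ ({p} : Set Q), t ∈ (P.popNFA p q).evalFrom {q} w) ↔ P.alph.trace w ∈ P.popSet q p
  simp [mem_evalFrom_popNFA, trace_mem_popSet hP]

/-! ### The automaton for the reachability relation -/

/-- States of the automaton for `reach`: the two sets read last, a set containing all letters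
popped so far, and a state of the pushdown system. -/
abbrev ReachState (Q Γ : Type*) : Type _ := Finset Γ × Finset Γ × Finset Γ × Q

/-- The automaton for `reach`. -/
def reachNFA (P : PushdownSystem Q Γ) (p q : Q) :
    NFA (P.alph.IndepSet × P.alph.IndepSet) (ReachState Q Γ) where
  start := {x | (∀ a, a ∈ x.1) ∧ (∀ a, a ∈ x.2.1) ∧ x.2.2.2 = q}
  step x L := {y | y.1 = L.1.1 ∧ y.2.1 = L.2.1 ∧
    (∀ b ∈ y.1, ∃ a ∈ x.1, P.alph.Dep a b) ∧ (∀ b ∈ y.2.1, ∃ a ∈ x.2.1, P.alph.Dep a b) ∧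
    (∀ b ∈ y.2.1, b ∈ y.1) ∧ (∀ b ∈ y.2.1, ∀ c ∈ x.2.2.1, ¬ P.alph.Dep c b) ∧
    (∀ c ∈ x.2.2.1, c ∈ y.2.2.1) ∧ (∀ c ∈ y.1, c ∉ y.2.1 → c ∈ y.2.2.1) ∧
    P.alph.diffTrace y.1 y.2.1 ∈ P.popSet x.2.2.2 y.2.2.2}
  accept := {x | x.2.2.2 = p}

/-- The right side lists what is left to check on a suffix, including its junction with the sets
read before. The third component is only required to contain the missing letters: enlarging it
merely strengthens the later tests. -/
theorem mem_acceptsFrom_reachNFA (hP : P.IsTPDS) {p q s : Q} {A B S : Finset Γ}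
    {W : List (P.alph.IndepSet × P.alph.IndepSet)} :
    W ∈ (P.reachNFA p q).acceptsFrom {(A, B, S, s)} ↔
      (P.alph.IsExtendedFoata (W.map Prod.fst) ∧
        ∀ x ∈ W.head?, ∀ b ∈ x.1.1, ∃ a ∈ A, P.alph.Dep a b) ∧
      (P.alph.IsExtendedFoata (W.map Prod.snd) ∧
        ∀ x ∈ W.head?, ∀ b ∈ x.2.1, ∃ a ∈ B, P.alph.Dep a b) ∧
      IsPrefixPair W ∧ (∀ x ∈ W, ∀ b ∈ x.2.1, ∀ c ∈ S, ¬ P.alph.Dep c b) ∧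
      remainder W ∈ P.popSet s p := by
  classical
  induction W generalizing A B S s with
  | nil =>
    simp [NFA.nil_mem_acceptsFrom, IsExtendedFoata, IsPrefixPair, remainder, one_mem_popSet hP,
      reachNFA]
  | cons x W ih =>
    have hrem : remainder (x :: W) = P.alph.diffTrace x.1.1 x.2.1 * remainder W := rfl
    rw [NFA.cons_mem_acceptsFrom_singleton, hrem, mul_mem_popSet hP]
    simp only [IsExtendedFoata, List.map_cons, List.isChain_cons, List.head?_map,
      Option.mem_def, Option.map_eq_some_iff, List.head?_cons, Option.some.injEq] at ih ⊢
    constructor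
    · rintro ⟨⟨A', B', S', r⟩, ⟨rfl, rfl, h1, h2, h3, h4, h5, h6, h7⟩, hW⟩
      rw [ih] at hW
      obtain ⟨⟨g1, g1'⟩, ⟨g2, g2'⟩, ⟨g3, g3'⟩, g4, g5⟩ := hW
      dsimp only at *
      refine ⟨⟨⟨?_, g1⟩, ?_⟩, ⟨⟨?_, g2⟩, ?_⟩, ⟨?_, ?_⟩, ?_, r, h7, g5⟩
      · rintro _ ⟨y, hy, rfl⟩
        exact g1' y hy
      · rintro _ rfl
        exact h1
      · rintro _ ⟨y, hy, rfl⟩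
        exact g2' y hy
      · rintro _ rfl
        exact h2
      · simp only [List.forall_mem_cons]
        exact ⟨h3, g3⟩
      · exact List.pairwise_cons.2
          ⟨fun y hy c hc hc' b hb => g4 y hy b hb c (h6 c hc hc'), g3'⟩
      · simp only [List.forall_mem_cons]
        exact ⟨h4, fun y hy b hb c hc => g4 y hy b hb c (h5 c hc)⟩
    · rintro ⟨⟨⟨f1, g1⟩, h1⟩, ⟨⟨f2, g2⟩, h2⟩, ⟨h3, h3'⟩, h4, r, h7, g5⟩
      simp only [List.forall_mem_cons] at h3 h4
      rw [List.pairwise_cons] at h3'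
      -- The least admissible third component, hence the least restrictive one.
      refine ⟨(x.1.1, x.2.1, S ∪ x.1.1.filter (· ∉ x.2.1), r),
        ⟨rfl, rfl, h1 x rfl, h2 x rfl, h3.1, h4.1, fun c hc => Finset.mem_union_left _ hc,
          fun c hc hc' => Finset.mem_union_right _ (Finset.mem_filter.2 ⟨hc, hc'⟩), h7⟩, ?_⟩
      rw [ih]
      refine ⟨⟨g1, fun y hy => f1 _ ⟨y, hy, rfl⟩⟩, ⟨g2, fun y hy => f2 _ ⟨y, hy, rfl⟩⟩,
        ⟨h3.2, h3'.2⟩, ?_, g5⟩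
      intro y hy b hb c hc
      rcases Finset.mem_union.1 hc with hc | hc
      · exact h4.2 y hy b hb c hc
      · rw [Finset.mem_filter] at hc
        exact h3'.1 y hy c hc.1 hc.2 b hb

theorem accepts_reachNFA [Fintype Γ] (hP : P.IsTPDS) (hE : P.WritesEmpty) (p q : Q) :
    (P.reachNFA p q).accepts = P.alph.foataLanguage (P.reach p q) := by
  ext W
  rw [NFA.accepts_eq_acceptsFrom_start, NFA.mem_acceptsFrom_iff_exists]
  change _ ↔ P.alph.IsExtendedFoata _ ∧ P.alph.IsExtendedFoata _ ∧ _ ∈ P.reach p q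
  rw [mem_reach_iff hP hE]
  constructor
  · rintro ⟨⟨A, B, S, s⟩, ⟨-, -, rfl⟩, h⟩
    rw [mem_acceptsFrom_reachNFA hP] at h
    exact ⟨h.1.1, h.2.1.1, _, h.2.2.2.2, foataTrace_eq_mul_remainder h.2.2.1⟩
  · rintro ⟨h1, h2, y, hy, e⟩
    obtain ⟨h3, rfl⟩ := isPrefixPair_and_eq_remainder h1 h2 e
    -- By reflexivity of dependence, the full alphabet as fictitious predecessor imposes nothing on
    -- the first pair.
    refine ⟨(Finset.univ, Finset.univ, ∅, q), ⟨by simp, by simp, rfl⟩, ?_⟩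
    rw [mem_acceptsFrom_reachNFA hP]
    exact ⟨⟨h1, fun x _ b _ => ⟨b, by simp, P.alph.refl b⟩⟩,
      ⟨h2, fun x _ b _ => ⟨b, by simp, P.alph.refl b⟩⟩, h3, by simp, hy⟩

end PushdownSystem

/-! ### Closure properties of primitive recursive predicates and functions -/

theorem List.sublists'_eq_foldr {α : Type*} (l : List α) :
    l.sublists' = l.foldr (fun a L => L ++ L.map (List.cons a)) [[]] := by
  induction l with
  | nil => rfl
  | cons a l ih => rw [List.sublists'_cons, ih, List.foldr_cons]

section PrimrecClosure

variable {α β γ : Type*} [Primcodable α] [Primcodable β] [Primcodable γ]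

theorem PrimrecPred.forall_mem {f : α → List β} {p : α → β → Prop} (hf : Primrec f)
    (hp : PrimrecRel p) : PrimrecPred fun a => ∀ b ∈ f a, p a b :=
  (PrimrecRel.forall_mem_list (R := fun b a => p a b) hp.swap).comp hf Primrec.id

theorem PrimrecPred.exists_mem {f : α → List β} {p : α → β → Prop} (hf : Primrec f)
    (hp : PrimrecRel p) : PrimrecPred fun a => ∃ b ∈ f a, p a b :=
  (PrimrecRel.exists_mem_list (R := fun b a => p a b) hp.swap).comp hf Primrec.id

theorem PrimrecPred.mem {f : α → β} {g : α → List β} (hf : Primrec f) (hg : Primrec g) :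
    PrimrecPred fun a => f a ∈ g a :=
  (PrimrecPred.exists_mem (p := fun a b => b = f a) hg
    (Primrec.eq.comp Primrec.snd (hf.comp Primrec.fst))).of_eq fun a => by simp

theorem PrimrecPred.imp {p q : α → Prop} (hp : PrimrecPred p) (hq : PrimrecPred q) :
    PrimrecPred fun a => p a → q a :=
  (hp.not.or hq).of_eq fun _ => imp_iff_not_or.symm

theorem Primrec.filter {f : α → List β} {p : α → β → Prop} [∀ a, DecidablePred (p a)]
    (hf : Primrec f) (hp : PrimrecRel p) : Primrec fun a => (f a).filter fun b => p a b :=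
  letI : DecidableRel fun b a => p a b := fun b a => inferInstanceAs (Decidable (p a b))
  (PrimrecRel.listFilter (R := fun b a => p a b) hp.swap).comp hf Primrec.id

theorem Primrec.product {f : α → List β} {g : α → List γ} (hf : Primrec f) (hg : Primrec g) :
    Primrec fun a => f a ×ˢ g a :=
  Primrec.list_flatMap hf
    (Primrec.list_map (hg.comp Primrec.fst)
      (Primrec.pair (Primrec.snd.comp Primrec.fst) Primrec.snd).to₂).to₂

theorem Primrec.list_sublists' : Primrec (@List.sublists' α) := by
  refine (Primrec.list_foldr (f := fun l : List α => l) (g := fun _ => [[]])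
    (h := fun _ z => z.2 ++ z.2.map (List.cons z.1)) Primrec.id (Primrec.const _) ?_).of_eq
    fun l => (List.sublists'_eq_foldr l).symm
  have h2 : Primrec fun z : List α × α × List (List α) => z.2.2 := Primrec.snd.comp Primrec.snd
  exact Primrec.list_append.comp h2 (Primrec.list_map h2
    (Primrec.list_cons.comp ((Primrec.fst.comp Primrec.snd).comp Primrec.fst) Primrec.snd).to₂)

end PrimrecClosure

namespace PDSCode

open DependenceAlphabet PushdownSystem

/-! ### The computed automata -/

/-- The listed pairs. -/
def pairs (c : PDSCode) : List (ℕ × ℕ) := c.2.2.1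

/-- The listed transitions. -/
def transitions (c : PDSCode) : List (ℕ × ℕ × List ℕ × ℕ) := c.2.2.2

/-- The code of `popNFA`. -/
def popCode (z : PDSCode × ℕ × ℕ) : NFACode ℕ :=
  (z.1.states, [z.2.2],
    (z.1.transitions.filter fun t => t.2.2.1 = []).map fun t => (t.2.2.2, t.2.1, t.1), [z.2.1])

/-- The described dependence relation on the natural numbers. -/
def CodeDep (d : List (ℕ × ℕ)) (a b : ℕ) : Prop := a = b ∨ (a, b) ∈ d ∨ (b, a) ∈ d

instance (d : List (ℕ × ℕ)) (a b : ℕ) : Decidable (CodeDep d a b) :=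
  inferInstanceAs (Decidable (_ ∨ _))

/-- The sources of the popping transitions that read `a` and lead to one of the states in `X`. -/
def popStep (c : PDSCode) (X : List ℕ) (a : ℕ) : List ℕ :=
  (c.transitions.filter fun t =>
    t.2.1 = a ∧ t.2.2.1 = [] ∧ t.2.2.2 < c.states ∧ t.2.2.2 ∈ X).map Prod.fst

/-- Codes of the states of `reachNFA`. -/
abbrev StateCode : Type := List ℕ × List ℕ × List ℕ × ℕ

/-- All codes of states of `reachNFA`. -/
def stateCodes (c : PDSCode) : List StateCode :=
  (List.range c.letters).sublists' ×ˢ (List.range c.letters).sublists' ×ˢ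
    (List.range c.letters).sublists' ×ˢ List.range c.states

/-- Every letter of `l'` depends on a letter of `l`. -/
def Covers (d : List (ℕ × ℕ)) (l l' : List ℕ) : Prop := ∀ b ∈ l', ∃ a ∈ l, CodeDep d a b

/-- No letter of `l'` depends on a letter of `l`. -/
def Avoids (d : List (ℕ × ℕ)) (l l' : List ℕ) : Prop := ∀ b ∈ l', ∀ a ∈ l, ¬ CodeDep d a b

instance (d : List (ℕ × ℕ)) (l l' : List ℕ) : Decidable (Covers d l l') :=
  inferInstanceAs (Decidable (∀ b ∈ l', ∃ a ∈ l, CodeDep d a b))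

instance (d : List (ℕ × ℕ)) (l l' : List ℕ) : Decidable (Avoids d l l') :=
  inferInstanceAs (Decidable (∀ b ∈ l', ∀ a ∈ l, ¬ CodeDep d a b))

/-- The transitions of `reachNFA` in terms of codes. -/
def CodeStep (c : PDSCode) (x y : StateCode) : Prop :=
  Covers c.pairs x.1 y.1 ∧ Covers c.pairs x.2.1 y.2.1 ∧ (∀ b ∈ y.2.1, b ∈ y.1) ∧
    Avoids c.pairs x.2.2.1 y.2.1 ∧ (∀ a ∈ x.2.2.1, a ∈ y.2.2.1) ∧
    (∀ a ∈ y.1, a ∉ y.2.1 → a ∈ y.2.2.1) ∧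
    y.2.2.2 ∈ (y.1.filter fun a => a ∉ y.2.1).foldl c.popStep [x.2.2.2]

instance (c : PDSCode) (x y : StateCode) : Decidable (CodeStep c x y) :=
  inferInstanceAs (Decidable (_ ∧ _))

/-- The state code with the given index. -/
def stateAt (c : PDSCode) (i : ℕ) : StateCode := c.stateCodes.getD i ([], [], [], 0)

/-- The code of `reachNFA`. -/
def reachCode (z : PDSCode × ℕ × ℕ) : NFACode (List ℕ × List ℕ) :=
  (z.1.stateCodes.length,
    (List.range z.1.stateCodes.length).filter fun i =>
      (∀ a ∈ List.range z.1.letters, a ∈ (z.1.stateAt i).1) ∧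
      (∀ a ∈ List.range z.1.letters, a ∈ (z.1.stateAt i).2.1) ∧ (z.1.stateAt i).2.2.2 = z.2.2,
    ((List.range z.1.stateCodes.length ×ˢ List.range z.1.stateCodes.length).filter
      fun e => CodeStep z.1 (z.1.stateAt e.1) (z.1.stateAt e.2)).map
      fun e => (e.1, ((z.1.stateAt e.2).1, (z.1.stateAt e.2).2.1), e.2),
    (List.range z.1.stateCodes.length).filter fun i => (z.1.stateAt i).2.2.2 = z.2.1)

/-! ### Computability -/

open Primrec

theorem primrec_states : Primrec states := fst

theorem primrec_letters : Primrec letters := fst.comp snd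

theorem primrec_pairs : Primrec pairs := fst.comp (snd.comp snd)

theorem primrec_transitions : Primrec transitions := snd.comp (snd.comp snd)

theorem primrec_popCode : Primrec popCode := by
  have h : Primrec fun t : ℕ × ℕ × List ℕ × ℕ => t.2.2.1 := fst.comp (snd.comp snd)
  have h' : Primrec fun t : ℕ × ℕ × List ℕ × ℕ => t.2.2.2 := snd.comp (snd.comp snd)
  refine (primrec_states.comp fst).pair (Primrec.pair ?_ (Primrec.pair ?_ ?_))
  · exact list_cons.comp (snd.comp snd) (const [])
  · refine list_map (Primrec.filter (primrec_transitions.comp fst) ?_) ?_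
    · exact Primrec.eq.comp (h.comp snd) (const [])
    · exact Primrec.pair (h'.comp snd) (Primrec.pair (fst.comp (snd.comp snd)) (fst.comp snd))
  · exact list_cons.comp (fst.comp snd) (const [])

theorem primrecPred_codeDep {α : Type*} [Primcodable α] {d : α → List (ℕ × ℕ)} {a b : α → ℕ}
    (hd : Primrec d) (ha : Primrec a) (hb : Primrec b) :
    PrimrecPred fun z => CodeDep (d z) (a z) (b z) :=
  (Primrec.eq.comp ha hb).or
    ((PrimrecPred.mem (ha.pair hb) hd).or (PrimrecPred.mem (hb.pair ha) hd))

theorem primrecPred_covers {α : Type*} [Primcodable α] {d : α → List (ℕ × ℕ)}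
    {l l' : α → List ℕ} (hd : Primrec d) (hl : Primrec l) (hl' : Primrec l') :
    PrimrecPred fun z => Covers (d z) (l z) (l' z) :=
  PrimrecPred.forall_mem hl' (PrimrecPred.exists_mem (hl.comp fst)
    (primrecPred_codeDep (hd.comp (fst.comp fst)) snd (snd.comp fst)))

theorem primrecPred_avoids {α : Type*} [Primcodable α] {d : α → List (ℕ × ℕ)}
    {l l' : α → List ℕ} (hd : Primrec d) (hl : Primrec l) (hl' : Primrec l') :
    PrimrecPred fun z => Avoids (d z) (l z) (l' z) :=
  PrimrecPred.forall_mem hl' (PrimrecPred.forall_mem (hl.comp fst)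
    (primrecPred_codeDep (hd.comp (fst.comp fst)) snd (snd.comp fst)).not)

theorem primrecPred_subset {α : Type*} [Primcodable α] {l l' : α → List ℕ} (hl : Primrec l)
    (hl' : Primrec l') : PrimrecPred fun z => ∀ a ∈ l z, a ∈ l' z :=
  PrimrecPred.forall_mem hl (PrimrecPred.mem snd (hl'.comp fst))

theorem primrec_popStep {α : Type*} [Primcodable α] {c : α → PDSCode} {X : α → List ℕ} {a : α → ℕ}
    (hc : Primrec c) (hX : Primrec X) (ha : Primrec a) :
    Primrec fun z => popStep (c z) (X z) (a z) := by
  have h1 : Primrec fun t : α × ℕ × ℕ × List ℕ × ℕ => t.2.2.1 := fst.comp (snd.comp snd)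
  have h2 : Primrec fun t : α × ℕ × ℕ × List ℕ × ℕ => t.2.2.2.1 :=
    fst.comp (snd.comp (snd.comp snd))
  have h3 : Primrec fun t : α × ℕ × ℕ × List ℕ × ℕ => t.2.2.2.2 :=
    snd.comp (snd.comp (snd.comp snd))
  refine list_map (Primrec.filter (primrec_transitions.comp hc) ?_) (fst.comp snd)
  exact (Primrec.eq.comp h1 (ha.comp fst)).and ((Primrec.eq.comp h2 (const [])).and
    ((nat_lt.comp h3 (primrec_states.comp (hc.comp fst))).and
      (PrimrecPred.mem h3 (hX.comp fst))))

theorem primrecPred_codeStep {α : Type*} [Primcodable α] {c : α → PDSCode} {x y : α → StateCode}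
    (hc : Primrec c) (hx : Primrec x) (hy : Primrec y) :
    PrimrecPred fun z => CodeStep (c z) (x z) (y z) := by
  have hd : Primrec fun z => (c z).pairs := primrec_pairs.comp hc
  have x1 : Primrec fun z => (x z).1 := fst.comp hx
  have x2 : Primrec fun z => (x z).2.1 := fst.comp (snd.comp hx)
  have x3 : Primrec fun z => (x z).2.2.1 := fst.comp (snd.comp (snd.comp hx))
  have x4 : Primrec fun z => (x z).2.2.2 := snd.comp (snd.comp (snd.comp hx))
  have y1 : Primrec fun z => (y z).1 := fst.comp hy
  have y2 : Primrec fun z => (y z).2.1 := fst.comp (snd.comp hy)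
  have y3 : Primrec fun z => (y z).2.2.1 := fst.comp (snd.comp (snd.comp hy))
  have y4 : Primrec fun z => (y z).2.2.2 := snd.comp (snd.comp (snd.comp hy))
  refine (primrecPred_covers hd x1 y1).and ((primrecPred_covers hd x2 y2).and
    ((primrecPred_subset y2 y1).and ((primrecPred_avoids hd x3 y2).and
    ((primrecPred_subset x3 y3).and (PrimrecPred.and ?_ ?_)))))
  · exact PrimrecPred.forall_mem y1
      ((PrimrecPred.mem snd (y2.comp fst)).not.imp (PrimrecPred.mem snd (y3.comp fst)))
  · refine PrimrecPred.mem y4 (list_foldl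
      (h := fun z (u : List ℕ × ℕ) => (c z).popStep u.1 u.2) (Primrec.filter y1 ?_) ?_ ?_)
    · exact (PrimrecPred.mem snd (y2.comp fst)).not
    · exact list_cons.comp x4 (const [])
    · exact primrec_popStep (hc.comp fst) (fst.comp snd) (snd.comp snd)

theorem primrec_stateCodes : Primrec stateCodes := by
  have h : Primrec fun c : PDSCode => (List.range c.letters).sublists' :=
    list_sublists'.comp (list_range.comp primrec_letters)
  exact h.product (h.product (h.product (list_range.comp primrec_states)))

theorem primrec_stateAt : Primrec₂ stateAt :=
  (list_getD _).comp (primrec_stateCodes.comp fst) snd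

theorem primrec_reachCode : Primrec reachCode := by
  have hlen : Primrec fun z : PDSCode × ℕ × ℕ => z.1.stateCodes.length :=
    list_length.comp (primrec_stateCodes.comp fst)
  have hr := list_range.comp hlen
  have hat : Primrec fun z : (PDSCode × ℕ × ℕ) × ℕ => z.1.1.stateAt z.2 :=
    primrec_stateAt.comp (fst.comp fst) snd
  have hat1 : Primrec fun z : (PDSCode × ℕ × ℕ) × ℕ × ℕ => z.1.1.stateAt z.2.1 :=
    primrec_stateAt.comp (fst.comp fst) (fst.comp snd)
  have hat2 : Primrec fun z : (PDSCode × ℕ × ℕ) × ℕ × ℕ => z.1.1.stateAt z.2.2 :=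
    primrec_stateAt.comp (fst.comp fst) (snd.comp snd)
  have hstate : Primrec fun z : (PDSCode × ℕ × ℕ) × ℕ => (z.1.1.stateAt z.2).2.2.2 :=
    snd.comp (snd.comp (snd.comp hat))
  have hlet : Primrec fun z : (PDSCode × ℕ × ℕ) × ℕ => List.range z.1.1.letters :=
    list_range.comp (primrec_letters.comp (fst.comp fst))
  refine hlen.pair (Primrec.pair ?_ (Primrec.pair ?_ ?_))
  · refine Primrec.filter hr ?_
    exact (primrecPred_subset hlet (fst.comp hat)).and
      ((primrecPred_subset hlet (fst.comp (snd.comp hat))).and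
        (Primrec.eq.comp hstate (snd.comp (snd.comp fst))))
  · refine list_map (Primrec.filter (hr.product hr) ?_) ?_
    · exact primrecPred_codeStep (fst.comp fst) hat1 hat2
    · exact Primrec.pair (fst.comp snd)
        (Primrec.pair (Primrec.pair (fst.comp hat2) (fst.comp (snd.comp hat2))) (snd.comp snd))
  · exact Primrec.filter hr (Primrec.eq.comp hstate (fst.comp (snd.comp fst)))

end PDSCode

namespace PDSCode

open DependenceAlphabet PushdownSystem

/-! ### Correctness of the computed automata -/

theorem mem_toPDS {c : PDSCode} {r s : Fin c.states} {a : Fin c.letters} :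
    (r, a, [], s) ∈ c.toPDS.Δ ↔ (r.val, a.val, [], s.val) ∈ c.transitions :=
  Iff.rfl

theorem accepts_popCode (c : PDSCode) (p q : Fin c.states) :
    ((popCode (c, p.val, q.val)).toNFA DenotesLetter).accepts =
      (c.toPDS.popNFA p q).accepts := by
  refine NFA.accepts_eq_of_surjective (fun s : Fin c.states => s) Function.surjective_id
    (fun s => List.mem_singleton.trans Fin.ext_iff.symm) (fun s a r => ?_)
    fun s => List.mem_singleton.trans Fin.ext_iff.symm
  change (∃ b, a.val = b ∧ (s.val, b, r.val) ∈
    (c.transitions.filter fun t => t.2.2.1 = []).map fun t => (t.2.2.2, t.2.1, t.1)) ↔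
    (r.val, a.val, [], s.val) ∈ c.transitions
  simp only [exists_eq_left', List.mem_map, List.mem_filter, decide_eq_true_eq]
  constructor
  · rintro ⟨⟨r', a', w, s'⟩, ⟨h, rfl⟩, e⟩
    simp only [Prod.mk.injEq] at e
    obtain ⟨rfl, rfl, rfl⟩ := e
    exact h
  · exact fun h => ⟨_, ⟨h, rfl⟩, rfl⟩

/-- Numbers that are no states may enter the list as sources, but the bound in `popStep` discards
them in the next round, in accordance with `toPDS`. -/
theorem mem_foldl_popStep {c : PDSCode} {w : List (Fin c.letters)} {X : List ℕ}
    {t : Fin c.states} :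
    t.val ∈ (w.map Fin.val).foldl c.popStep X ↔ ∃ s, s.val ∈ X ∧ c.toPDS.PopPath s w t := by
  induction w generalizing X with
  | nil => simp [PopPath]
  | cons a w ih =>
    rw [List.map_cons, List.foldl_cons, ih]
    simp only [PopPath, popStep, mem_toPDS, List.mem_map, List.mem_filter, decide_eq_true_eq]
    constructor
    · rintro ⟨r, ⟨⟨r', a', v, s⟩, ⟨h, rfl, rfl, hs, hX⟩, rfl⟩, hr⟩
      exact ⟨⟨s, hs⟩, hX, r, h, hr⟩
    · rintro ⟨s, hX, r, h, hr⟩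
      exact ⟨r, ⟨_, ⟨h, rfl, rfl, s.isLt, hX⟩, rfl⟩, hr⟩

/-- The set of letters enumerated by a list. -/
def letterSet (m : ℕ) (l : List ℕ) : Finset (Fin m) := Finset.univ.filter fun a => a.val ∈ l

theorem mem_letterSet {m : ℕ} {l : List ℕ} {a : Fin m} : a ∈ letterSet m l ↔ a.val ∈ l := by
  simp [letterSet]

theorem exists_letterSet_eq {m : ℕ} (A : Finset (Fin m)) :
    ∃ l ∈ (List.range m).sublists', letterSet m l = A := by
  refine ⟨(List.range m).filter fun i => ∃ a ∈ A, a.val = i,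
    List.mem_sublists'.2 List.filter_sublist, ?_⟩
  ext a
  rw [mem_letterSet]
  simp only [List.mem_filter, List.mem_range, a.isLt, true_and, decide_eq_true_eq]
  exact ⟨fun ⟨b, hb, e⟩ => Fin.ext e ▸ hb, fun h => ⟨a, h, rfl⟩⟩

variable {m : ℕ} {l l' : List ℕ}

theorem lt_of_mem_sublists' (hl : l ∈ (List.range m).sublists') {i : ℕ} (hi : i ∈ l) : i < m :=
  List.mem_range.1 ((List.mem_sublists'.1 hl).subset hi)

theorem forall_mem_iff_letterSet (hl : l ∈ (List.range m).sublists') {φ : ℕ → Prop} :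
    (∀ i ∈ l, φ i) ↔ ∀ a ∈ letterSet m l, φ a.val :=
  ⟨fun h _ ha => h _ (mem_letterSet.1 ha),
    fun h i hi => h ⟨i, lt_of_mem_sublists' hl hi⟩ (mem_letterSet.2 hi)⟩

theorem exists_mem_iff_letterSet (hl : l ∈ (List.range m).sublists') {φ : ℕ → Prop} :
    (∃ i ∈ l, φ i) ↔ ∃ a ∈ letterSet m l, φ a.val :=
  ⟨fun ⟨i, hi, h⟩ => ⟨⟨i, lt_of_mem_sublists' hl hi⟩, mem_letterSet.2 hi, h⟩,
    fun ⟨_, ha, h⟩ => ⟨_, mem_letterSet.1 ha, h⟩⟩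

theorem image_val_eq_toFinset_iff (hl : l ∈ (List.range m).sublists') {A : Finset (Fin m)} :
    A.image Fin.val = l.toFinset ↔ letterSet m l = A := by
  constructor
  · intro h
    ext a
    rw [mem_letterSet, ← List.mem_toFinset, ← h, Finset.mem_image]
    exact ⟨fun ⟨b, hb, e⟩ => Fin.ext e ▸ hb, fun h => ⟨a, h, rfl⟩⟩
  · rintro rfl
    ext i
    simp only [Finset.mem_image, mem_letterSet, List.mem_toFinset]
    exact ⟨fun ⟨a, h, e⟩ => e ▸ h, fun h => ⟨⟨i, lt_of_mem_sublists' hl h⟩, h, rfl⟩⟩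

theorem dep_toPDS {c : PDSCode} {a b : Fin c.letters} :
    c.toPDS.alph.Dep a b ↔ CodeDep c.pairs a.val b.val :=
  or_congr_left Fin.ext_iff

theorem mem_stateCodes {c : PDSCode} {x : StateCode} :
    x ∈ c.stateCodes ↔ x.1 ∈ (List.range c.letters).sublists' ∧
      x.2.1 ∈ (List.range c.letters).sublists' ∧ x.2.2.1 ∈ (List.range c.letters).sublists' ∧
      x.2.2.2 < c.states := by
  obtain ⟨A, B, S, s⟩ := x
  simp only [stateCodes, List.mem_product, List.mem_range]

theorem stateAt_mem {c : PDSCode} {i : ℕ} (h : i < c.stateCodes.length) :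
    c.stateAt i ∈ c.stateCodes := by
  rw [stateAt, List.getD_eq_getElem _ _ h]
  exact List.getElem_mem h

/-- The state described by a code. -/
def decodeState (c : PDSCode) (x : StateCode) (hx : x ∈ c.stateCodes) :
    ReachState (Fin c.states) (Fin c.letters) :=
  (letterSet _ x.1, letterSet _ x.2.1, letterSet _ x.2.2.1,
    ⟨x.2.2.2, (mem_stateCodes.1 hx).2.2.2⟩)

theorem exists_decodeState_eq (c : PDSCode) (y : ReachState (Fin c.states) (Fin c.letters)) :
    ∃ i, ∃ h : i < c.stateCodes.length, decodeState c (c.stateAt i) (stateAt_mem h) = y := by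
  obtain ⟨A, B, S, s⟩ := y
  obtain ⟨lA, hA, rfl⟩ := exists_letterSet_eq A
  obtain ⟨lB, hB, rfl⟩ := exists_letterSet_eq B
  obtain ⟨lS, hS, rfl⟩ := exists_letterSet_eq S
  have hx : (lA, lB, lS, s.val) ∈ c.stateCodes := mem_stateCodes.2 ⟨hA, hB, hS, s.isLt⟩
  obtain ⟨i, hi, e⟩ := List.getElem_of_mem hx
  have e' : c.stateAt i = (lA, lB, lS, s.val) := by
    rw [stateAt, List.getD_eq_getElem _ _ hi, e]
  refine ⟨i, hi, ?_⟩
  simp only [decodeState, e']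

/-- The missing letters may be popped in the order in which the code lists them, since membership in
`popSet` depends on the trace only. -/
theorem diffTrace_mem_popSet_iff {c : PDSCode} (hP : c.toPDS.IsTPDS) {s t : Fin c.states}
    (hl : l ∈ (List.range c.letters).sublists')
    (hI : (letterSet c.letters l : Set (Fin c.letters)).Pairwise c.toPDS.alph.Indep) :
    c.toPDS.alph.diffTrace (letterSet c.letters l) (letterSet c.letters l') ∈
        c.toPDS.popSet s t ↔
      t.val ∈ (l.filter fun a => a ∉ l').foldl c.popStep [s.val] := by
  obtain ⟨w, hw⟩ : ∃ w : List (Fin c.letters), w.map Fin.val = l.filter fun a => a ∉ l' := by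
    refine ⟨(l.filter fun a => a ∉ l').pmap Fin.mk
      fun i hi => lt_of_mem_sublists' hl (List.mem_of_mem_filter hi), ?_⟩
    simp [List.map_pmap]
  have hnd : w.Nodup := by
    -- A sublist of `List.range` has no repetitions, so each letter is popped once.
    refine List.Nodup.of_map Fin.val ?_
    rw [hw]
    exact ((List.mem_sublists'.1 hl).nodup List.nodup_range).filter _
  rw [← trace_eq_diffTrace hI hnd, trace_mem_popSet hP, ← hw, mem_foldl_popStep]
  · simp only [List.mem_singleton, ← Fin.ext_iff, exists_eq_left]
  · intro a
    rw [← List.mem_map_of_injective Fin.val_injective, hw]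
    simp [mem_letterSet]

theorem decodeState_mem_step_iff {c : PDSCode} (hP : c.toPDS.IsTPDS) {p q : Fin c.states}
    {x y : StateCode} (hx : x ∈ c.stateCodes) (hy : y ∈ c.stateCodes)
    {L : c.toPDS.alph.IndepSet × c.toPDS.alph.IndepSet} :
    decodeState c y hy ∈ (c.toPDS.reachNFA p q).step (decodeState c x hx) L ↔
      DenotesPair c.toPDS.alph (y.1, y.2.1) L ∧ CodeStep c x y := by
  obtain ⟨x1, x2, x3, -⟩ := mem_stateCodes.1 hx
  obtain ⟨y1, y2, y3, -⟩ := mem_stateCodes.1 hy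
  rw [DenotesPair, image_val_eq_toFinset_iff y1, image_val_eq_toFinset_iff y2, and_assoc]
  refine and_congr_right fun e1 => and_congr_right fun e2 => ?_
  -- State codes may contain dependent letters; independence comes from the label `L`, so
  -- transitions into other codes denote nothing.
  have hI : (letterSet c.letters y.1 : Set (Fin c.letters)).Pairwise c.toPDS.alph.Indep := by
    rw [show letterSet c.letters y.1 = L.1.1 from e1]
    exact L.1.2
  simp only [decodeState, CodeStep, Covers, Avoids, diffTrace_mem_popSet_iff hP y1 hI, dep_toPDS,
    forall_mem_iff_letterSet y1, forall_mem_iff_letterSet y2, forall_mem_iff_letterSet x3,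
    exists_mem_iff_letterSet x1, exists_mem_iff_letterSet x2, mem_letterSet]

theorem accepts_reachCode (c : PDSCode) (hP : c.toPDS.IsTPDS) (p q : Fin c.states) :
    ((reachCode (c, p.val, q.val)).toNFA (DenotesPair c.toPDS.alph)).accepts =
      (c.toPDS.reachNFA p q).accepts := by
  refine NFA.accepts_eq_of_surjective
    (fun i : Fin c.stateCodes.length => decodeState c (c.stateAt i) (stateAt_mem i.isLt))
    (fun y => ?_) (fun i => ?_) (fun i L j => ?_) fun i => ?_
  · obtain ⟨i, hi, h⟩ := exists_decodeState_eq c y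
    exact ⟨⟨i, hi⟩, h⟩
  · change i.val ∈ (List.range c.stateCodes.length).filter _ ↔ (∀ a, _) ∧ (∀ a, _) ∧ _
    simp only [List.mem_filter, List.mem_range, decide_eq_true_eq, decodeState, mem_letterSet,
      Fin.ext_iff, Fin.forall_iff]
    exact and_iff_right i.isLt
  · rw [decodeState_mem_step_iff hP]
    change (∃ b, DenotesPair c.toPDS.alph b L ∧ (i.val, b, j.val) ∈ List.map _ _) ↔ _
    simp only [List.mem_map, List.mem_filter, List.mem_product, List.mem_range,
      decide_eq_true_eq, Prod.exists, Prod.mk.injEq]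
    constructor
    · rintro ⟨_, _, hd, _, _, ⟨-, h⟩, rfl, ⟨rfl, rfl⟩, rfl⟩
      exact ⟨hd, h⟩
    · rintro ⟨hd, h⟩
      exact ⟨_, _, hd, _, _, ⟨⟨i.isLt, j.isLt⟩, h⟩, rfl, ⟨rfl, rfl⟩, rfl⟩
  · change i.val ∈ (List.range c.stateCodes.length).filter _ ↔ _ = p
    simp only [List.mem_filter, List.mem_range, decide_eq_true_eq, decodeState, Fin.ext_iff]
    exact and_iff_right i.isLt

end PDSCode

/-- For a trace-pushdown system all of whose transitions write the empty word, every relation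
`reach_{p,q}` is fnf-automatic and of the form `Id · (K × {1})` with `K` recognizable. Moreover,
automata for `reach_{p,q}` and for `K` can be computed from the system and the two states. -/
theorem mainTheorem8 :
    (∀ (Q : Type*) (Γ : Type*) [Finite Q] [Finite Γ] (P : PushdownSystem Q Γ),
      P.IsTPDS → P.WritesEmpty → ∀ p q : Q,
        P.alph.FnfAutomatic (P.reach p q) ∧
        ∃ K : Set P.alph.Trace, P.alph.Recognizable K ∧
          P.reach p q = P.alph.idRel * (K ×ˢ {1})) ∧
    ∃ (autReach : PDSCode × ℕ × ℕ → NFACode (List ℕ × List ℕ))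
      (autK : PDSCode × ℕ × ℕ → NFACode ℕ),
      Computable autReach ∧ Computable autK ∧
      ∀ c : PDSCode, c.toPDS.IsTPDS → c.toPDS.WritesEmpty → ∀ p q : Fin c.states,
        ((autReach (c, p.val, q.val)).toNFA (DenotesPair c.toPDS.alph)).accepts =
          c.toPDS.alph.foataLanguage (c.toPDS.reach p q) ∧
        ∃ K : Set c.toPDS.alph.Trace,
          ((autK (c, p.val, q.val)).toNFA DenotesLetter).accepts =
            ({w | c.toPDS.alph.trace w ∈ K} : Language (Fin c.letters)) ∧
          c.toPDS.reach p q = c.toPDS.alph.idRel * (K ×ˢ {1}) := by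
  refine ⟨fun Q Γ _ _ P hP hE p q => ⟨?_, P.popSet q p, ?_, P.reach_eq hP hE p q⟩,
    PDSCode.reachCode, PDSCode.popCode, PDSCode.primrec_reachCode.to_comp,
    PDSCode.primrec_popCode.to_comp, fun c hP hE p q => ⟨?_, c.toPDS.popSet q p, ?_,
      c.toPDS.reach_eq hP hE p q⟩⟩
  · have := Fintype.ofFinite Γ
    rw [DependenceAlphabet.FnfAutomatic, ← PushdownSystem.accepts_reachNFA hP hE p q]
    exact NFA.isRegular_accepts _
  · rw [DependenceAlphabet.Recognizable, ← PushdownSystem.accepts_popNFA hP p q]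
    exact NFA.isRegular_accepts _
  · rw [PDSCode.accepts_reachCode c hP p q, PushdownSystem.accepts_reachNFA hP hE p q]
  · rw [PDSCode.accepts_popCode c p q, PushdownSystem.accepts_popNFA hP p q]
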